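/- Let $\mathbb{R}_\infty=\mathbb{R}\cup\{\infty\}$ and let $\mathrm{GL}^+(2)$ be the set of real $2\times2$ matrices with positive determinant. Call a function $W\colon\mathrm{GL}^+(2)\to\mathbb{R}_\infty$ - objective and isotropic if $W(Q_1FQ_2)=W(F)$ for all $F\in\mathrm{GL}^+(2)$ and all $Q_1,Q_2\in\mathrm{SO}(2)$; - rank-one convex if $W((1-t)F+t(F+H))\le(1-t)W(F)+tW(F+H)$ for all $t\in[0,1]$ and all $F\in\mathrm{GL}^+(2)$, $H\in\mathbb{R}^{2\times2}$ with $\operatorname{rank}H=1$ and $F+H\in\mathrm{GL}^+(2)$ (the segment between $F$ and $F+H$ then lies in $\mathrm{GL}^+(2)$); - polyconvex if there is a convex function $P\colon\mathbb{R}^{2\times2}\times\mathbb{R}\to\mathbb{R}_\infty$ with $W(F)=P(F,\det F)$ for all $F\in\mathrm{GL}^+(2)$. Mielke's conjecture asserts: if $W\colon\mathrm{GL}^+(2)\to\mathbb{R}_\infty$ is objective, isotropic and rank-one convex, and if for every $c\in\mathbb{R}$ the sublevel set $S_c=\{F\in\mathbb{R}^{2\times2} : \det F>0,\ W(F)\le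 c\}$ is compact and connected (the empty set being regarded as connected), then $W$ is polyconvex. Let $W_0\colon\mathrm{GL}^+(2)\to\mathbb{R}$, $$W_0(F)=\frac{\|F\|^2}{\det F}-\log\Bigl(\frac{\|F\|^2}{\det F}\Bigr)+\log(\det F)+\frac1{\det F},$$ where $\|F\|=\sup_{|h|=1}|Fh|$ is the operator norm with respect to the Euclidean norm on $\mathbb{R}^2$. Then $W_0$ is objective, isotropic and rank-one convex, all its sublevel sets $S_c$, $c\in\mathbb{R}$, are compact and connected, but $W_0$ is not polyconvex. In particular, Mielke's conjecture is false. -/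

import Mathlib

noncomputable section

namespace Mielke

/-- Real `2 × 2` matrices, with the usual topology of `ℝ⁴`. -/
abbrev Mat2 : Type := Matrix (Fin 2) (Fin 2) ℝ

/-- `GL⁺(2)`, the group of real `2 × 2` matrices with positive determinant. -/
abbrev GLp2 : Type := Matrix.GLPos (Fin 2) ℝ

/-- The matrix underlying an element of `GL⁺(2)`. -/
def mat (F : GLp2) : Mat2 := ((F : GL (Fin 2) ℝ) : Mat2)

/-- Convexity of a function with values in `ℝ ∪ {∞}` on a real vector space
(with the convention `0 * ∞ = 0`, which makes the cases `t = 0` and `t = 1` trivial). -/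
def IsConvex {E : Type*} [AddCommGroup E] [Module ℝ E] (P : E → WithTop ℝ) : Prop :=
  ∀ (x y : E) (t : ℝ), 0 ≤ t → t ≤ 1 →
    P ((1 - t) • x + t • y) ≤ ((1 - t : ℝ) : WithTop ℝ) * P x + (t : WithTop ℝ) * P y

/-- Objectivity together with isotropy: invariance under `SO(2)` from the left and the right. -/
def IsObjectiveIsotropic (W : GLp2 → WithTop ℝ) : Prop :=
  ∀ Q₁ ∈ Matrix.specialOrthogonalGroup (Fin 2) ℝ,
  ∀ Q₂ ∈ Matrix.specialOrthogonalGroup (Fin 2) ℝ,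
  ∀ F G : GLp2, mat G = Q₁ * mat F * Q₂ → W G = W F

/-- Rank-one convexity on `GL⁺(2)`: convexity along all segments in `GL⁺(2)` whose end points
`F` and `F + H` differ by a matrix `H` of rank one. (Such a segment lies in `GL⁺(2)` as soon as its
end points do; `K` is the intermediate point.) -/
def IsRankOneConvex (W : GLp2 → WithTop ℝ) : Prop :=
  ∀ (F G K : GLp2) (H : Mat2) (t : ℝ), H.rank = 1 → 0 ≤ t → t ≤ 1 →
    mat G = mat F + H → mat K = (1 - t) • mat F + t • (mat F + H) →
    W K ≤ ((1 - t : ℝ) : WithTop ℝ) * W F + (t : WithTop ℝ) * W G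

/-- Polyconvexity on `GL⁺(2)`: `W F = P (F, det F)` for a convex `P : ℝ^{2×2} × ℝ → ℝ ∪ {∞}`. -/
def IsPolyconvex (W : GLp2 → WithTop ℝ) : Prop :=
  ∃ P : Mat2 × ℝ → WithTop ℝ, IsConvex P ∧ ∀ F : GLp2, W F = P (mat F, (mat F).det)

/-- The sublevel set `S_c = {X ∈ ℝ^{2×2} | det X > 0, W X ≤ c}`, as a set of matrices. -/
def sublevel (W : GLp2 → WithTop ℝ) (c : ℝ) : Set Mat2 :=
  {X | ∃ F : GLp2, mat F = X ∧ W F ≤ (c : WithTop ℝ)}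

/-- Mielke's conjecture. The empty set counts as connected: a function with compact sublevel sets
always has empty ones. -/
def MielkeConjecture : Prop :=
  ∀ W : GLp2 → WithTop ℝ,
    IsObjectiveIsotropic W → IsRankOneConvex W →
    (∀ c : ℝ, IsCompact (sublevel W c) ∧ IsPreconnected (sublevel W c)) →
    IsPolyconvex W

/-- The operator norm with respect to the Euclidean norm on `ℝ²`, i.e. the largest singular value. -/
def opNorm (X : Mat2) : ℝ := ‖Matrix.toEuclideanCLM (n := Fin 2) (𝕜 := ℝ) X‖

/-- The energy `W₀`. -/
def W₀ (F : GLp2) : ℝ :=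
  opNorm (mat F) ^ 2 / (mat F).det - Real.log (opNorm (mat F) ^ 2 / (mat F).det)
    + Real.log (mat F).det + 1 / (mat F).det

end Mielke

end

/-! Split a matrix into conformal and anticonformal parts of moduli `x` and `y`. The singular values
are `x + y` and `|x - y|`, the determinant is `x² - y²`, and where it is positive the energy becomes
`2x/(x-y) + 2 log (x-y) - 1 + 1/det` (`opNorm_eq`, `energy_eq`). Along a rank-one line `det` is
affine, so `1/det` is convex; `x²` and `y²` are quadratics with the same leading coefficient, and
Cauchy–Schwarz makes the remaining part convex (`radialProfile_le`). Sublevel sets are compact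
because the energy controls `1/det` and the norm. They are connected because shrinking `y`, and then
moving `x` towards `1`, never raises the energy. Polyconvexity fails because the energy grows only
logarithmically under scaling: two convex combinations in `(F, det F)` bound its value at `121 • 1`
by something too small. -/

namespace Mielke

open Set Filter Topology

/-! ### Convexity of the radial part along rank-one lines -/

/-- The function `2x/(x-y) + 2 log (x-y)` along the curve `x² = A + 2Bt + ht²`,
`y² = C + 2Dt + ht²`. -/
noncomputable def radialProfile (A B C D h t : ℝ) : ℝ :=
  2 * √(A + 2 * B * t + h * t ^ 2) / (√(A + 2 * B * t + h * t ^ 2) - √(C + 2 * D * t + h * t ^ 2))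
    + 2 * Real.log (√(A + 2 * B * t + h * t ^ 2) - √(C + 2 * D * t + h * t ^ 2))

theorem hasDerivAt_sqrt_quadratic (A B h t : ℝ) (hp : 0 < A + 2 * B * t + h * t ^ 2) :
    HasDerivAt (fun t : ℝ => √(A + 2 * B * t + h * t ^ 2))
      ((B + h * t) / √(A + 2 * B * t + h * t ^ 2)) t := by
  have h1 : HasDerivAt (fun t : ℝ => A + 2 * B * t + h * t ^ 2) (2 * B + h * (2 * t)) t := by
    have := (((hasDerivAt_id t).const_mul (2 * B)).const_add A).add
      (((hasDerivAt_id t).pow 2).const_mul h)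
    refine this.congr_deriv ?_
    norm_num
  convert h1.sqrt hp.ne' using 1
  have : √(A + 2 * B * t + h * t ^ 2) ≠ 0 := (Real.sqrt_pos.2 hp).ne'
  field_simp

theorem hasDerivAt_radialProfile (A B C D h t : ℝ) (hC : 0 < C + 2 * D * t + h * t ^ 2)
    (hCA : C + 2 * D * t + h * t ^ 2 < A + 2 * B * t + h * t ^ 2) :
    HasDerivAt (radialProfile A B C D h)
      ((2 * (B + h * t) - 4 * √(C + 2 * D * t + h * t ^ 2) *
          ((B + h * t) / √(A + 2 * B * t + h * t ^ 2)) + 2 * (D + h * t)) /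
        (√(A + 2 * B * t + h * t ^ 2) - √(C + 2 * D * t + h * t ^ 2)) ^ 2) t := by
  have hx := hasDerivAt_sqrt_quadratic A B h t (hC.trans hCA)
  have hy := hasDerivAt_sqrt_quadratic C D h t hC
  have hx0 := Real.sqrt_pos.2 (hC.trans hCA)
  have hy0 := Real.sqrt_pos.2 hC
  have hs : 0 < √(A + 2 * B * t + h * t ^ 2) - √(C + 2 * D * t + h * t ^ 2) :=
    sub_pos.2 (Real.sqrt_lt_sqrt hC.le hCA)
  have := ((hx.const_mul 2).div (hx.sub hy) hs.ne').add (((hx.sub hy).log hs.ne').const_mul 2)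
  refine this.congr_deriv ?_
  simp only [Pi.sub_apply]
  generalize √(A + 2 * B * t + h * t ^ 2) = x at *
  generalize √(C + 2 * D * t + h * t ^ 2) = y at *
  have := hs.ne'
  field_simp
  ring

theorem exists_hasDerivAt_nonneg_deriv_radialProfile (A B C D h t : ℝ) (hAB : B ^ 2 ≤ h * A)
    (hC : 0 < C + 2 * D * t + h * t ^ 2)
    (hCA : C + 2 * D * t + h * t ^ 2 < A + 2 * B * t + h * t ^ 2) :
    ∃ v, 0 ≤ v ∧ HasDerivAt (fun t =>
      (2 * (B + h * t) - 4 * √(C + 2 * D * t + h * t ^ 2) *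
          ((B + h * t) / √(A + 2 * B * t + h * t ^ 2)) + 2 * (D + h * t)) /
        (√(A + 2 * B * t + h * t ^ 2) - √(C + 2 * D * t + h * t ^ 2)) ^ 2) v t := by
  have hx := hasDerivAt_sqrt_quadratic A B h t (hC.trans hCA)
  have hy := hasDerivAt_sqrt_quadratic C D h t hC
  have hx0 := Real.sqrt_pos.2 (hC.trans hCA)
  have hy0 := Real.sqrt_pos.2 hC
  have hs : 0 < √(A + 2 * B * t + h * t ^ 2) - √(C + 2 * D * t + h * t ^ 2) :=
    sub_pos.2 (Real.sqrt_lt_sqrt hC.le hCA)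
  have hB : HasDerivAt (fun t : ℝ => B + h * t) h t := by
    simpa using ((hasDerivAt_id t).const_mul h).const_add B
  have hD : HasDerivAt (fun t : ℝ => D + h * t) h t := by
    simpa using ((hasDerivAt_id t).const_mul h).const_add D
  have key := (((hB.const_mul 2).sub ((hy.const_mul 4).mul (hB.div hx hx0.ne'))).add
    (hD.const_mul 2)).div ((hx.sub hy).pow 2) (pow_pos hs 2).ne'
  refine ⟨_, ?_, key⟩
  have hx2 : √(A + 2 * B * t + h * t ^ 2) ^ 2 = A + 2 * B * t + h * t ^ 2 :=
    Real.sq_sqrt (hC.trans hCA).le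
  have hcs : (B + h * t) ^ 2 ≤ h * √(A + 2 * B * t + h * t ^ 2) ^ 2 := by
    rw [hx2]; nlinarith
  simp only [Pi.sub_apply, Pi.mul_apply, Pi.div_apply, Pi.add_apply, Pi.pow_apply]
  generalize √(A + 2 * B * t + h * t ^ 2) = x at *
  generalize √(C + 2 * D * t + h * t ^ 2) = y at *
  generalize B + h * t = b at *
  generalize D + h * t = d at *
  -- The second derivative, written as a square plus the Cauchy–Schwarz defect `h x² - b²`.
  have hval : 0 ≤ 4 / (x - y) ^ 3 *
      (y * (d / y - b / x) ^ 2 + (x - y) ^ 2 / x * ((h * x ^ 2 - b ^ 2) / x ^ 2)) := by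
    have : 0 ≤ h * x ^ 2 - b ^ 2 := sub_nonneg.2 hcs
    positivity
  convert hval using 1
  have := hs.ne'
  field_simp
  ring

theorem convexOn_radialProfile (A B C D h : ℝ) (hAB : B ^ 2 ≤ h * A)
    (hC : ∀ t ∈ Icc (0 : ℝ) 1, 0 < C + 2 * D * t + h * t ^ 2)
    (hCA : ∀ t ∈ Icc (0 : ℝ) 1, C + 2 * D * t + h * t ^ 2 < A + 2 * B * t + h * t ^ 2) :
    ConvexOn ℝ (Icc 0 1) (radialProfile A B C D h) := by
  have h2 : ∀ t : ℝ, ∃ v, t ∈ Icc (0 : ℝ) 1 → 0 ≤ v ∧ HasDerivAt (fun t =>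
      (2 * (B + h * t) - 4 * √(C + 2 * D * t + h * t ^ 2) *
          ((B + h * t) / √(A + 2 * B * t + h * t ^ 2)) + 2 * (D + h * t)) /
        (√(A + 2 * B * t + h * t ^ 2) - √(C + 2 * D * t + h * t ^ 2)) ^ 2) v t := by
    intro t
    by_cases ht : t ∈ Icc (0 : ℝ) 1
    · obtain ⟨v, hv⟩ := exists_hasDerivAt_nonneg_deriv_radialProfile A B C D h t hAB
        (hC t ht) (hCA t ht)
      exact ⟨v, fun _ => hv⟩
    · exact ⟨0, fun h => absurd h ht⟩
  choose v hv using h2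
  have h1 := fun t ht => hasDerivAt_radialProfile A B C D h t (hC t ht) (hCA t ht)
  exact convexOn_of_hasDerivWithinAt2_nonneg (convex_Icc 0 1)
    (fun t ht => (h1 t ht).continuousAt.continuousWithinAt)
    (fun t ht => (h1 t (interior_subset ht)).hasDerivWithinAt)
    (fun t ht => ((hv t (interior_subset ht)).2).hasDerivWithinAt)
    (fun t ht => (hv t (interior_subset ht)).1)

/-- The root `y` need not be differentiable where it vanishes, so `C` is raised to `C + ε` and `ε →
0⁺`. -/
theorem radialProfile_le (A B C D h t : ℝ) (hAB : B ^ 2 ≤ h * A)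
    (hC : ∀ t ∈ Icc (0 : ℝ) 1, 0 ≤ C + 2 * D * t + h * t ^ 2)
    (h0 : C < A) (h1 : C + 2 * D < A + 2 * B) (ht0 : 0 ≤ t) (ht1 : t ≤ 1) :
    radialProfile A B C D h t ≤
      (1 - t) * radialProfile A B C D h 0 + t * radialProfile A B C D h 1 := by
  -- The difference of the two quadratics is affine in `t`, so the gap at the end points suffices.
  have hlt : ∀ ε < min (A - C) (A + 2 * B - (C + 2 * D)), ∀ t ∈ Icc (0 : ℝ) 1,
      (C + ε) + 2 * D * t + h * t ^ 2 < A + 2 * B * t + h * t ^ 2 := by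
    intro ε hε t ht
    obtain ⟨e0, e1⟩ := lt_min_iff.1 hε
    rcases eq_or_lt_of_le ht.1 with h | h
    · subst h; linarith
    · nlinarith [ht.2, mul_nonneg (sub_nonneg.2 ht.2) (sub_nonneg.2 e0.le),
        mul_pos h (sub_pos.2 e1)]
  have hm : 0 < min (A - C) (A + 2 * B - (C + 2 * D)) :=
    lt_min (by linarith) (by linarith)
  have hlim : ∀ t ∈ Icc (0 : ℝ) 1,
      Tendsto (fun ε => radialProfile A B (C + ε) D h t) (𝓝[>] 0) (𝓝 (radialProfile A B C D h t)) := by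
    intro t ht
    have hne : √(A + 2 * B * t + h * t ^ 2) - √((C + 0) + 2 * D * t + h * t ^ 2) ≠ 0 := by
      refine (sub_pos.2 (Real.sqrt_lt_sqrt ?_ (hlt 0 hm t ht))).ne'
      simpa using hC t ht
    have : ContinuousAt (fun ε => radialProfile A B (C + ε) D h t) 0 := by
      unfold radialProfile
      have hs : ContinuousAt (fun ε => √(A + 2 * B * t + h * t ^ 2) -
          √((C + ε) + 2 * D * t + h * t ^ 2)) 0 := by fun_prop
      exact (continuousAt_const.div hs hne).add (continuousAt_const.mul (hs.log hne))
    have h2 := this.tendsto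
    simp only [add_zero] at h2
    exact h2.mono_left nhdsWithin_le_nhds
  refine le_of_tendsto_of_tendsto (hlim t ⟨ht0, ht1⟩)
    (((hlim 0 (by simp)).const_mul (1 - t)).add ((hlim 1 (by simp)).const_mul t)) ?_
  filter_upwards [Ioo_mem_nhdsGT hm] with ε hε
  have := (convexOn_radialProfile A B (C + ε) D h hAB
    (fun t ht => by linarith [hC t ht, hε.1]) (hlt ε hε.2)).2
    (x := 0) (by simp) (y := 1) (by simp) (sub_nonneg.2 ht1) ht0 (by ring)
  simpa using this

/-! ### Conformal and anticonformal coordinates -/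

/-- The energy `W₀` as a function on all `2 × 2` matrices. -/
noncomputable def energy (X : Mat2) : ℝ :=
  opNorm X ^ 2 / X.det - Real.log (opNorm X ^ 2 / X.det) + Real.log X.det + 1 / X.det

theorem W₀_eq_energy (F : GLp2) : W₀ F = energy (mat F) := rfl

theorem det_mat_pos (F : GLp2) : 0 < (mat F).det := F.2

theorem exists_mat_eq {X : Mat2} (hX : 0 < X.det) : ∃ F : GLp2, mat F = X :=
  ⟨⟨Matrix.GeneralLinearGroup.mkOfDetNeZero X hX.ne', hX⟩, rfl⟩

/-- Squared modulus of the conformal part of `X`. -/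
noncomputable def confSq (X : Mat2) : ℝ := ((X 0 0 + X 1 1) ^ 2 + (X 1 0 - X 0 1) ^ 2) / 4

/-- Squared modulus of the anticonformal part of `X`. -/
noncomputable def antiSq (X : Mat2) : ℝ := ((X 0 0 - X 1 1) ^ 2 + (X 1 0 + X 0 1) ^ 2) / 4

theorem confSq_nonneg (X : Mat2) : 0 ≤ confSq X := by unfold confSq; positivity

theorem antiSq_nonneg (X : Mat2) : 0 ≤ antiSq X := by unfold antiSq; positivity

theorem det_eq_confSq_sub_antiSq (X : Mat2) : X.det = confSq X - antiSq X := by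
  rw [Matrix.det_fin_two, confSq, antiSq]; ring

theorem continuous_confSq : Continuous confSq := by unfold confSq; fun_prop

theorem continuous_antiSq : Continuous antiSq := by unfold antiSq; fun_prop

theorem norm_toEuclideanCLM_sq (X : Mat2) (v : EuclideanSpace ℝ (Fin 2)) :
    ‖Matrix.toEuclideanCLM (n := Fin 2) (𝕜 := ℝ) X v‖ ^ 2 =
      (X 0 0 * v 0 + X 0 1 * v 1) ^ 2 + (X 1 0 * v 0 + X 1 1 * v 1) ^ 2 := by
  rw [EuclideanSpace.norm_sq_eq]
  simp [Fin.sum_univ_two, Matrix.mulVec, dotProduct]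

theorem quadratic_nonneg_of_sq_le {u w q : ℝ} (hu : 0 ≤ u) (hw : 0 ≤ w) (hq : q ^ 2 ≤ u * w)
    (a b : ℝ) : 0 ≤ u * a ^ 2 + 2 * q * (a * b) + w * b ^ 2 := by
  rcases hu.eq_or_lt with rfl | hu
  · have : q = 0 := by nlinarith [sq_nonneg q]
    subst this
    nlinarith [mul_nonneg hw (sq_nonneg b)]
  · refine nonneg_of_mul_nonneg_right ?_ hu
    nlinarith [sq_nonneg (u * a + q * b), mul_nonneg (sub_nonneg.2 hq) (sq_nonneg b)]

/-- Trace and determinant of `XᵀX` show that its eigenvalues are `n² = (x+y)²` and `m² = (x-y)²`.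
Hence `n² - XᵀX` is positive semidefinite, while no smaller `N²` can replace `n²`. -/
theorem opNorm_eq (X : Mat2) : opNorm X = √(confSq X) + √(antiSq X) := by
  have hx := Real.sq_sqrt (confSq_nonneg X)
  have hy := Real.sq_sqrt (antiSq_nonneg X)
  have hx0 := Real.sqrt_nonneg (confSq X)
  have hy0 := Real.sqrt_nonneg (antiSq X)
  have htr : 2 * (confSq X + antiSq X) =
      X 0 0 ^ 2 + X 0 1 ^ 2 + X 1 0 ^ 2 + X 1 1 ^ 2 := by unfold confSq antiSq; ring
  set x := √(confSq X)
  set y := √(antiSq X)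
  set n := x + y with hn
  have hdet : ((X 0 0 ^ 2 + X 1 0 ^ 2) * (X 0 1 ^ 2 + X 1 1 ^ 2) -
      (X 0 0 * X 0 1 + X 1 0 * X 1 1) ^ 2) = ((x + y) * (x - y)) ^ 2 := by
    rw [show (x + y) * (x - y) = x ^ 2 - y ^ 2 by ring, hx, hy, ← det_eq_confSq_sub_antiSq,
      Matrix.det_fin_two]
    ring
  have htr' : (X 0 0 ^ 2 + X 1 0 ^ 2) + (X 0 1 ^ 2 + X 1 1 ^ 2) = (x + y) ^ 2 + (x - y) ^ 2 := by
    rw [show (x + y) ^ 2 + (x - y) ^ 2 = 2 * (x ^ 2 + y ^ 2) by ring, hx, hy, htr]; ring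
  have hquad : ∀ a b : ℝ, (X 0 0 * a + X 0 1 * b) ^ 2 + (X 1 0 * a + X 1 1 * b) ^ 2 =
      (X 0 0 ^ 2 + X 1 0 ^ 2) * a ^ 2 + 2 * (X 0 0 * X 0 1 + X 1 0 * X 1 1) * (a * b) +
        (X 0 1 ^ 2 + X 1 1 ^ 2) * b ^ 2 := by intros; ring
  have hv := fun v => norm_toEuclideanCLM_sq X v
  simp only [hquad] at hv
  generalize X 0 0 ^ 2 + X 1 0 ^ 2 = p at *
  generalize X 0 1 ^ 2 + X 1 1 ^ 2 = r at *
  generalize X 0 0 * X 0 1 + X 1 0 * X 1 1 = q at *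
  have hmn : (x - y) ^ 2 ≤ n ^ 2 := by nlinarith [mul_nonneg hx0 hy0]
  generalize x - y = m at *
  have hn0 : 0 ≤ n := by positivity
  rw [← hn] at hdet htr'
  clear_value n
  apply le_antisymm
  · refine ContinuousLinearMap.opNorm_le_bound _ hn0 fun v => ?_
    refine le_of_sq_le_sq ?_ (by positivity)
    rw [hv, mul_pow, EuclideanSpace.norm_sq_eq, Fin.sum_univ_two, Real.norm_eq_abs,
      Real.norm_eq_abs, sq_abs, sq_abs]
    have huw : (n ^ 2 - p) * (n ^ 2 - r) = q ^ 2 := by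
      linear_combination (-n ^ 2) * htr' + hdet
    have hu : 0 ≤ n ^ 2 - p := by nlinarith [sq_nonneg q]
    have hw : 0 ≤ n ^ 2 - r := by nlinarith [sq_nonneg q]
    have := quadratic_nonneg_of_sq_le hu hw huw.ge (v 0) (-v 1)
    linarith
  · by_contra! hlt
    set N := opNorm X with hN
    have hN0 : 0 ≤ N := norm_nonneg _
    have hall : ∀ a b : ℝ, p * a ^ 2 + 2 * q * (a * b) + r * b ^ 2 ≤ N ^ 2 * (a ^ 2 + b ^ 2) := by
      intro a b
      have h1 := (Matrix.toEuclideanCLM (n := Fin 2) (𝕜 := ℝ) X).le_opNorm !₂[a, b]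
      have h2 := pow_le_pow_left₀ (norm_nonneg _) h1 2
      rw [hv, mul_pow, EuclideanSpace.norm_sq_eq, Fin.sum_univ_two, Real.norm_eq_abs,
        Real.norm_eq_abs, sq_abs, sq_abs] at h2
      simpa [hN, opNorm] using h2
    have hu : 0 ≤ N ^ 2 - p := by linarith [hall 1 0]
    have hw : 0 ≤ N ^ 2 - r := by linarith [hall 0 1]
    have hq : q ^ 2 ≤ (N ^ 2 - p) * (N ^ 2 - r) := by
      have h1 := discrim_le_zero (a := N ^ 2 - p) (b := -2 * q) (c := N ^ 2 - r)
        fun a => by linarith [hall a 1]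
      unfold discrim at h1
      linarith
    have hlt2 : N ^ 2 < n ^ 2 := pow_lt_pow_left₀ hlt hN0 two_ne_zero
    have hprod : 0 ≤ (N ^ 2 - n ^ 2) * (N ^ 2 - m ^ 2) := by
      have : (N ^ 2 - n ^ 2) * (N ^ 2 - m ^ 2) = (N ^ 2 - p) * (N ^ 2 - r) - q ^ 2 := by
        linear_combination N ^ 2 * htr' - hdet
      linarith
    -- `hu` and `hw` add up to `2N² ≥ n² + m²`; with `N² < n²` this gives `N² > m²`, so the product
    -- in `hprod` would be negative.
    nlinarith

theorem sqrt_antiSq_lt {X : Mat2} (hX : 0 < X.det) : √(antiSq X) < √(confSq X) :=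
  Real.sqrt_lt_sqrt (antiSq_nonneg X) (by linarith [det_eq_confSq_sub_antiSq X])

theorem energy_eq {X : Mat2} (hX : 0 < X.det) :
    energy X = 2 * √(confSq X) / (√(confSq X) - √(antiSq X))
      + 2 * Real.log (√(confSq X) - √(antiSq X)) - 1 + 1 / X.det := by
  have hlt := sqrt_antiSq_lt hX
  have hy0 := Real.sqrt_nonneg (antiSq X)
  have hd : X.det = (√(confSq X) + √(antiSq X)) * (√(confSq X) - √(antiSq X)) := by
    rw [det_eq_confSq_sub_antiSq]
    nth_rewrite 1 [← Real.sq_sqrt (confSq_nonneg X), ← Real.sq_sqrt (antiSq_nonneg X)]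
    ring
  have hs : 0 < √(confSq X) - √(antiSq X) := sub_pos.2 hlt
  have hn : 0 < √(confSq X) + √(antiSq X) := by linarith
  rw [energy, opNorm_eq, Real.log_div (by positivity) hX.ne', hd, Real.log_pow,
    Real.log_mul hn.ne' hs.ne']
  generalize √(confSq X) = x at *
  generalize √(antiSq X) = y at *
  have := hs.ne'
  have := hn.ne'
  field_simp
  push_cast
  ring

theorem continuousAt_energy {X : Mat2} (hX : 0 < X.det) : ContinuousAt energy X := by
  have hdet : Continuous fun X : Mat2 => X.det := continuous_id.matrix_det
  have hev : ∀ᶠ Y in 𝓝 X, 0 < Matrix.det Y := hdet.continuousAt.eventually (lt_mem_nhds hX)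
  have hc : ContinuousAt (fun X => √(confSq X)) X := continuous_confSq.sqrt.continuousAt
  have ha : ContinuousAt (fun X => √(antiSq X)) X := continuous_antiSq.sqrt.continuousAt
  have hs := (sub_pos.2 (sqrt_antiSq_lt hX)).ne'
  have hmain := (((continuousAt_const (y := (2 : ℝ))).mul hc).div (hc.sub ha) hs).add
    ((continuousAt_const (y := (2 : ℝ))).mul ((hc.sub ha).log hs)) |>.sub
    (continuousAt_const (y := (1 : ℝ))) |>.add
    ((continuousAt_const (y := (1 : ℝ))).div hdet.continuousAt hX.ne')
  refine hmain.congr ?_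
  filter_upwards [hev] with Y hY
  exact (energy_eq hY).symm

/-! ### Invariance and rank-one convexity -/

theorem isObjectiveIsotropic_W₀ : IsObjectiveIsotropic (fun F => (W₀ F : WithTop ℝ)) := by
  intro Q₁ h₁ Q₂ h₂ F G h
  rw [Matrix.mem_specialOrthogonalGroup_iff] at h₁ h₂
  have hdet : (mat G).det = (mat F).det := by rw [h]; simp [h₁.2, h₂.2]
  have u : ∀ Q ∈ Matrix.orthogonalGroup (Fin 2) ℝ,
      Matrix.toEuclideanCLM (n := Fin 2) (𝕜 := ℝ) Q ∈ unitary _ := fun Q hQ =>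
    Unitary.map_mem Matrix.toEuclideanCLM hQ
  have hn : opNorm (mat G) = opNorm (mat F) := by
    unfold opNorm
    rw [h, map_mul, map_mul, CStarRing.norm_mul_mem_unitary _ (u _ h₂.1),
      CStarRing.norm_mem_unitary_mul _ (u _ h₁.1)]
  simp only [W₀, hdet, hn]

theorem isRankOneConvex_W₀ : IsRankOneConvex (fun F => (W₀ F : WithTop ℝ)) := by
  intro F G K H t hrank ht0 ht1 hG hK
  have hH : H.det = 0 := by
    by_contra hne
    have := Matrix.rank_of_isUnit H ((Matrix.isUnit_iff_isUnit_det H).2 (Ne.isUnit hne))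
    simp [hrank] at this
  have hF0 := det_mat_pos F
  have hG0 := det_mat_pos G
  have hK0 := det_mat_pos K
  -- Singularity of `H` is what gives both quadratics the same leading coefficient.
  have hh : antiSq H = confSq H := by linarith [det_eq_confSq_sub_antiSq H]
  set X := mat F with hX
  set B := ((X 0 0 + X 1 1) * (H 0 0 + H 1 1) + (X 1 0 - X 0 1) * (H 1 0 - H 0 1)) / 4 with hB
  set D := ((X 0 0 - X 1 1) * (H 0 0 - H 1 1) + (X 1 0 + X 0 1) * (H 1 0 + H 0 1)) / 4 with hD
  have hK' : mat K = X + t • H := by rw [hK]; ext i j; simp; ring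
  have hc : ∀ t : ℝ, confSq (X + t • H) = confSq X + 2 * B * t + confSq H * t ^ 2 := by
    intro t; simp [confSq, hB]; ring
  have ha : ∀ t : ℝ, antiSq (X + t • H) = antiSq X + 2 * D * t + confSq H * t ^ 2 := by
    intro t; rw [← hh]; simp [antiSq, hD]; ring
  have hdet : ∀ t : ℝ, (X + t • H).det = (1 - t) * X.det + t * (X + H).det := by
    intro t
    have h1 := hc 1
    have h2 := ha 1
    rw [one_smul] at h1 h2
    rw [det_eq_confSq_sub_antiSq, det_eq_confSq_sub_antiSq X, det_eq_confSq_sub_antiSq (X + H),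
      hc, ha, h1, h2]
    ring
  have hen : ∀ t : ℝ, 0 < (X + t • H).det → energy (X + t • H) =
      radialProfile (confSq X) B (antiSq X) D (confSq H) t - 1 + 1 / (X + t • H).det := by
    intro t ht
    rw [energy_eq ht, hc, ha, radialProfile]
  have hG' : mat G = X + (1 : ℝ) • H := by rw [hG, one_smul]
  have hF' : X = X + (0 : ℝ) • H := by simp
  have hrad := radialProfile_le (confSq X) B (antiSq X) D (confSq H) t
    (by rw [hB, confSq, confSq]
        nlinarith [sq_nonneg ((X 0 0 + X 1 1) * (H 1 0 - H 0 1) - (X 1 0 - X 0 1) * (H 0 0 + H 1 1))])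
    (fun t _ => ha t ▸ antiSq_nonneg _)
    (by linarith [det_eq_confSq_sub_antiSq X])
    (by have h := det_eq_confSq_sub_antiSq (X + (1 : ℝ) • H)
        rw [hc, ha] at h
        rw [hG'] at hG0
        linarith) ht0 ht1
  have hinv : 1 / (mat K).det ≤ (1 - t) * (1 / X.det) + t * (1 / (mat G).det) := by
    rw [hK', hdet, hG]
    have := (convexOn_zpow (𝕜 := ℝ) (-1)).2 (x := X.det) hF0 (y := (X + H).det) (by rwa [← hG])
      (sub_nonneg.2 ht1) ht0 (by ring)
    simpa using this
  have hfin : energy (mat K) ≤ (1 - t) * energy X + t * energy (mat G) := by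
    have e0 := hen 0 (by simpa using hF0)
    have e1 := hen 1 (by rwa [← hG'])
    have et := hen t (by rwa [← hK'])
    rw [← hK'] at et
    rw [← hG'] at e1
    rw [← hF'] at e0
    rw [e0, e1, et]
    linarith
  simp only [W₀_eq_energy]
  exact_mod_cast hfin

/-! ### Compactness of sublevel sets -/

theorem mem_sublevel_W₀ {c : ℝ} {X : Mat2} :
    X ∈ sublevel (fun F => (W₀ F : WithTop ℝ)) c ↔ 0 < X.det ∧ energy X ≤ c := by
  constructor
  · rintro ⟨F, rfl, h⟩
    exact ⟨det_mat_pos F, by simpa [W₀_eq_energy] using h⟩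
  · rintro ⟨hX, h⟩
    obtain ⟨F, rfl⟩ := exists_mat_eq hX
    exact ⟨F, rfl, by simpa [W₀_eq_energy] using h⟩

theorem log_le_half {u : ℝ} (hu : 0 < u) : Real.log u ≤ u / 2 := by
  have h1 := Real.log_le_sub_one_of_pos (half_pos hu)
  rw [Real.log_div hu.ne' two_ne_zero] at h1
  have h2 := Real.log_le_sub_one_of_pos (zero_lt_two' ℝ)
  linarith

theorem opNorm_pos {X : Mat2} (hX : 0 < X.det) : 0 < opNorm X := by
  rw [opNorm_eq]
  linarith [sqrt_antiSq_lt hX, Real.sqrt_nonneg (antiSq X)]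

/-- With `K = ‖X‖²/det` and `u = 1/det` the energy is `(K - log K) + (u - log u)`, and `s - log s`
is at least both `1` and `s/2`. -/
theorem bounds_of_energy_le {X : Mat2} {c : ℝ} (hX : 0 < X.det) (h : energy X ≤ c) :
    1 / X.det ≤ 2 * (c - 1) ∧ opNorm X ^ 2 ≤ 2 * (c - 1) * Real.exp (c - 1) := by
  have hK : 0 < opNorm X ^ 2 / X.det := div_pos (pow_pos (opNorm_pos hX) 2) hX
  have hu : 0 < 1 / X.det := by positivity
  have k1 := Real.log_le_sub_one_of_pos hK
  have k2 := log_le_half hK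
  have u1 := Real.log_le_sub_one_of_pos hu
  have u2 := log_le_half hu
  rw [one_div, Real.log_inv] at u1 u2
  rw [energy] at h
  rw [one_div] at h hu ⊢
  refine ⟨by linarith, ?_⟩
  have hd : X.det ≤ Real.exp (c - 1) := by
    rw [← Real.log_le_iff_le_exp hX]; linarith
  have hK2 : opNorm X ^ 2 / X.det ≤ 2 * (c - 1) := by linarith
  calc opNorm X ^ 2 = opNorm X ^ 2 / X.det * X.det := by field_simp
    _ ≤ 2 * (c - 1) * Real.exp (c - 1) := mul_le_mul hK2 hd hX.le (hK.le.trans hK2)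

theorem sq_apply_le_opNorm_sq (X : Mat2) (i j : Fin 2) : X i j ^ 2 ≤ 2 * opNorm X ^ 2 := by
  have hsum : X 0 0 ^ 2 + X 0 1 ^ 2 + X 1 0 ^ 2 + X 1 1 ^ 2 ≤ 2 * opNorm X ^ 2 := by
    have h1 : X 0 0 ^ 2 + X 0 1 ^ 2 + X 1 0 ^ 2 + X 1 1 ^ 2 = 2 * (confSq X + antiSq X) := by
      unfold confSq antiSq; ring
    rw [h1, opNorm_eq]
    nlinarith [Real.sq_sqrt (confSq_nonneg X), Real.sq_sqrt (antiSq_nonneg X),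
      mul_nonneg (Real.sqrt_nonneg (confSq X)) (Real.sqrt_nonneg (antiSq X))]
  refine le_trans ?_ hsum
  fin_cases i <;> fin_cases j <;> simp only [Fin.zero_eta, Fin.mk_one] <;>
    nlinarith [sq_nonneg (X 0 0), sq_nonneg (X 0 1), sq_nonneg (X 1 0), sq_nonneg (X 1 1)]

theorem isCompact_sublevel_W₀ (c : ℝ) :
    IsCompact (sublevel (fun F => (W₀ F : WithTop ℝ)) c) := by
  rcases le_or_gt c 1 with hc | hc
  · convert isCompact_empty
    refine eq_empty_of_forall_notMem fun X hX => ?_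
    obtain ⟨hX, h⟩ := mem_sublevel_W₀.1 hX
    have := (bounds_of_energy_le hX h).1
    have : 0 < 1 / X.det := by positivity
    linarith
  have hδ : 0 < 2 * (c - 1) := by linarith
  set R := √(2 * (2 * (c - 1) * Real.exp (c - 1)))
  have hcomp : IsCompact (univ.pi fun _ => univ.pi fun _ => Icc (-R) R : Set Mat2) :=
    isCompact_univ_pi fun _ => isCompact_univ_pi fun _ => isCompact_Icc
  refine hcomp.of_isClosed_subset ?_ ?_
  -- The lower bound on `det` replaces the open condition `0 < det` by a closed one.
  · have heq : sublevel (fun F => (W₀ F : WithTop ℝ)) c =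
        {X : Mat2 | 1 / (2 * (c - 1)) ≤ X.det} ∩ energy ⁻¹' Iic c := by
      ext X
      rw [mem_sublevel_W₀]
      constructor
      · rintro ⟨hX, h⟩
        refine ⟨?_, h⟩
        have := (bounds_of_energy_le hX h).1
        rw [mem_ofPred_eq, one_div_le hδ hX]
        exact this
      · rintro ⟨hX, h⟩
        exact ⟨lt_of_lt_of_le (by positivity) hX, h⟩
    rw [heq]
    refine ContinuousOn.preimage_isClosed_of_isClosed (fun X hX => ?_) ?_ isClosed_Iic
    · exact (continuousAt_energy (lt_of_lt_of_le (by positivity) hX)).continuousWithinAt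
    · exact isClosed_le continuous_const continuous_id.matrix_det
  · intro X hX i _ j _
    obtain ⟨hX, h⟩ := mem_sublevel_W₀.1 hX
    rw [mem_Icc, ← abs_le]
    refine Real.abs_le_sqrt ((sq_apply_le_opNorm_sq X i j).trans ?_)
    linarith [(bounds_of_energy_le hX h).2]

/-! ### Connectedness of sublevel sets -/

theorem div_add_log_antitone {x r r' : ℝ} (hr : 0 < r) (hrr' : r ≤ r') (hx : r' ≤ x) :
    x / r' + Real.log r' ≤ x / r + Real.log r := by
  have hr' := hr.trans_le hrr'
  have h1 := Real.log_le_sub_one_of_pos (div_pos hr' hr)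
  rw [Real.log_div hr'.ne' hr.ne'] at h1
  have h2 : r' / r - 1 ≤ x / r - x / r' := by
    rw [div_sub_one hr.ne', div_sub_div _ _ hr.ne' hr'.ne', div_le_div_iff₀ hr (by positivity)]
    nlinarith [mul_nonneg (mul_nonneg hr.le (sub_nonneg.2 hrr')) (sub_nonneg.2 hx)]
  linarith

theorem one_div_add_log_monotone {r r' : ℝ} (hr : 1 ≤ r) (hrr' : r ≤ r') :
    1 / r + Real.log r ≤ 1 / r' + Real.log r' := by
  have hr0 : 0 < r := by linarith
  have hr' := hr0.trans_le hrr'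
  have h1 := Real.log_le_sub_one_of_pos (div_pos hr0 hr')
  rw [Real.log_div hr0.ne' hr'.ne'] at h1
  have h2 : r / r' - 1 ≤ 1 / r' - 1 / r := by
    rw [div_sub_one hr'.ne', div_sub_div _ _ hr'.ne' hr0.ne', div_le_div_iff₀ hr' (by positivity)]
    nlinarith [mul_nonneg (mul_nonneg hr'.le (sub_nonneg.2 hrr')) (sub_nonneg.2 hr)]
  linarith

/-- The matrix with conformal part `(a, b)` and anticonformal part `(p, q)`. -/
def ofParts (a b p q : ℝ) : Mat2 := !![a + p, q - b; q + b, a - p]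

theorem confSq_ofParts (a b p q : ℝ) : confSq (ofParts a b p q) = a ^ 2 + b ^ 2 := by
  simp [confSq, ofParts]; ring

theorem antiSq_ofParts (a b p q : ℝ) : antiSq (ofParts a b p q) = p ^ 2 + q ^ 2 := by
  simp [antiSq, ofParts]; ring

theorem det_ofParts (a b p q : ℝ) :
    (ofParts a b p q).det = a ^ 2 + b ^ 2 - (p ^ 2 + q ^ 2) := by
  rw [det_eq_confSq_sub_antiSq, confSq_ofParts, antiSq_ofParts]

theorem exists_eq_ofParts (X : Mat2) : ∃ a b p q, X = ofParts a b p q := by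
  refine ⟨(X 0 0 + X 1 1) / 2, (X 1 0 - X 0 1) / 2, (X 0 0 - X 1 1) / 2, (X 1 0 + X 0 1) / 2, ?_⟩
  ext i j
  fin_cases i <;> fin_cases j <;> simp [ofParts] <;> ring

theorem continuous_ofParts {f g h k : ℝ → ℝ} (hf : Continuous f) (hg : Continuous g)
    (hh : Continuous h) (hk : Continuous k) :
    Continuous fun t => ofParts (f t) (g t) (h t) (k t) := by
  unfold ofParts
  refine continuous_matrix fun i j => ?_
  fin_cases i <;> fin_cases j <;> simp <;> fun_prop

theorem energy_conformal {a b : ℝ} (h : 0 < a ^ 2 + b ^ 2) :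
    energy (ofParts a b 0 0) = 1 + (1 / (a ^ 2 + b ^ 2) + Real.log (a ^ 2 + b ^ 2)) := by
  have hd : 0 < (ofParts a b 0 0).det := by rw [det_ofParts]; simpa using h
  rw [energy_eq hd, det_ofParts, confSq_ofParts, antiSq_ofParts]
  have := (Real.sqrt_pos.2 h).ne'
  simp only [ne_eq, OfNat.ofNat_ne_zero, not_false_eq_true, zero_pow, add_zero, Real.sqrt_zero,
    sub_zero]
  rw [mul_div_assoc, div_self this, Real.log_sqrt h.le]
  ring

/-- Shrinking `y` increases both `x - y ≤ x` and `det`, and `x/r + log r` is antitone for `r ≤ x`.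
-/
theorem energy_shrink_antiSq {X Y : Mat2} (hX : 0 < X.det) (hc : confSq Y = confSq X)
    (ha : antiSq Y ≤ antiSq X) : 0 < Y.det ∧ energy Y ≤ energy X := by
  have hle : X.det ≤ Y.det := by
    rw [det_eq_confSq_sub_antiSq, det_eq_confSq_sub_antiSq, hc]; linarith
  have hY := hX.trans_le hle
  refine ⟨hY, ?_⟩
  have hs := sub_pos.2 (sqrt_antiSq_lt hX)
  have hsq := Real.sqrt_le_sqrt ha
  have h1 := div_add_log_antitone hs (sub_le_sub_left hsq (√(confSq X)))
    (sub_le_self _ (Real.sqrt_nonneg _))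
  have h2 := one_div_le_one_div_of_le hX hle
  rw [energy_eq hX, energy_eq hY, hc]
  rw [mul_div_assoc, mul_div_assoc]
  linarith

theorem energy_conformal_le {d e : ℝ} (hd : 0 < d) (he : e ∈ uIcc d 1) :
    0 < e ∧ 1 / e + Real.log e ≤ 1 / d + Real.log d := by
  rcases le_total d 1 with h | h
  · rw [uIcc_of_le h] at he
    exact ⟨hd.trans_le he.1, div_add_log_antitone hd he.1 he.2⟩
  · rw [uIcc_of_ge h] at he
    exact ⟨by linarith [he.1], one_div_add_log_monotone he.1 he.2⟩

theorem isPreconnected_sublevel_W₀ (c : ℝ) :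
    IsPreconnected (sublevel (fun F => (W₀ F : WithTop ℝ)) c) := by
  refine isPreconnected_of_forall (ofParts 1 0 0 0) fun X hX => ?_
  obtain ⟨hX0, hXc⟩ := mem_sublevel_W₀.1 hX
  obtain ⟨a, b, p, q, rfl⟩ := exists_eq_ofParts X
  have hxpos : 0 < a ^ 2 + b ^ 2 := by
    rw [det_ofParts] at hX0; nlinarith [sq_nonneg p, sq_nonneg q]
  have hconf : 1 + (1 / (a ^ 2 + b ^ 2) + Real.log (a ^ 2 + b ^ 2)) ≤ c := by
    rw [← energy_conformal hxpos]
    refine (energy_shrink_antiSq hX0 ?_ ?_).2.trans hXc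
    · rw [confSq_ofParts, confSq_ofParts]
    · rw [antiSq_ofParts, antiSq_ofParts]; nlinarith [sq_nonneg p, sq_nonneg q]
  set ρ := √(a ^ 2 + b ^ 2) with hρ
  have hρ0 : 0 < ρ := Real.sqrt_pos.2 hxpos
  have hρ2 : ρ ^ 2 = a ^ 2 + b ^ 2 := Real.sq_sqrt hxpos.le
  obtain ⟨θ, hcos, hsin⟩ : ∃ θ, ρ * Real.cos θ = a ∧ ρ * Real.sin θ = b := by
    refine ⟨Complex.arg ⟨a, b⟩, ?_, ?_⟩
    · have := Complex.norm_mul_cos_arg ⟨a, b⟩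
      rwa [Complex.norm_eq_sqrt_sq_add_sq] at this
    · have := Complex.norm_mul_sin_arg ⟨a, b⟩
      rwa [Complex.norm_eq_sqrt_sq_add_sq] at this
  have hcs : ∀ r θ : ℝ, (r * Real.cos θ) ^ 2 + (r * Real.sin θ) ^ 2 = r ^ 2 := fun r θ => by
    linear_combination r ^ 2 * Real.cos_sq_add_sin_sq θ
  have hmem : ∀ r ∈ uIcc ρ 1, ∀ θ, ofParts (r * Real.cos θ) (r * Real.sin θ) 0 0 ∈
      sublevel (fun F => (W₀ F : WithTop ℝ)) c := by
    intro r hr θ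
    have hr0 : 0 < r := lt_of_lt_of_le (lt_min hρ0 one_pos) hr.1
    have hr2 : r ^ 2 ∈ uIcc (ρ ^ 2) 1 := by
      rcases le_total ρ 1 with h | h
      · rw [uIcc_of_le h] at hr
        rw [uIcc_of_le (pow_le_one₀ hρ0.le h)]
        exact ⟨pow_le_pow_left₀ hρ0.le hr.1 2, pow_le_one₀ hr0.le hr.2⟩
      · rw [uIcc_of_ge h] at hr
        rw [uIcc_of_ge (one_le_pow₀ h)]
        exact ⟨one_le_pow₀ hr.1, pow_le_pow_left₀ hr0.le hr.2 2⟩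
    obtain ⟨h1, h2⟩ := energy_conformal_le (pow_pos hρ0 2) hr2
    rw [hρ2] at h2
    rw [mem_sublevel_W₀, det_ofParts, energy_conformal (by rw [hcs]; exact h1), hcs]
    exact ⟨by simpa using h1, by linarith⟩
  -- Three connected pieces: a segment killing the anticonformal part, a radial segment to modulus
  -- `1`, and the circle of rotations, which contains the identity.
  have hs1 : IsPreconnected ((fun t : ℝ => ofParts a b (t * p) (t * q)) '' Icc 0 1) :=
    isPreconnected_Icc.image _ (continuous_ofParts continuous_const continuous_const
      (by fun_prop) (by fun_prop)).continuousOn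
  have hs2 : IsPreconnected
      ((fun r : ℝ => ofParts (r * Real.cos θ) (r * Real.sin θ) 0 0) '' uIcc ρ 1) :=
    isPreconnected_uIcc.image _ (continuous_ofParts (by fun_prop) (by fun_prop)
      continuous_const continuous_const).continuousOn
  have hs3 : IsPreconnected
      ((fun φ : ℝ => ofParts (1 * Real.cos φ) (1 * Real.sin φ) 0 0) '' univ) :=
    isPreconnected_univ.image _ (continuous_ofParts (by fun_prop) (by fun_prop)
      continuous_const continuous_const).continuousOn
  have h12 := IsPreconnected.union' (t := _ '' uIcc ρ 1) ?_ hs1 hs2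
  have h123 := IsPreconnected.union' (t := _ '' univ) ?_ h12 hs3
  rotate_left
  · exact ⟨ofParts (1 * Real.cos θ) (1 * Real.sin θ) 0 0,
      Or.inr ⟨1, right_mem_uIcc, rfl⟩, ⟨θ, mem_univ _, rfl⟩⟩
  · exact ⟨ofParts a b 0 0, ⟨0, by simp, by simp⟩,
      ⟨ρ, left_mem_uIcc, by simp only [hcos, hsin]⟩⟩
  refine ⟨_, ?_, ?_, ?_, h123⟩
  · rintro _ ((⟨t, ht, rfl⟩ | ⟨r, hr, rfl⟩) | ⟨φ, -, rfl⟩)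
    · rw [mem_sublevel_W₀]
      have h := energy_shrink_antiSq (Y := ofParts a b (t * p) (t * q)) hX0
        (by rw [confSq_ofParts, confSq_ofParts])
        (by rw [antiSq_ofParts, antiSq_ofParts]
            nlinarith [pow_le_one₀ ht.1 ht.2 (n := 2), sq_nonneg p, sq_nonneg q])
      exact ⟨h.1, h.2.trans hXc⟩
    · exact hmem r hr θ
    · exact hmem 1 right_mem_uIcc φ
  · exact Or.inr ⟨0, mem_univ _, by simp⟩
  · exact Or.inl (Or.inl ⟨1, by simp, by simp⟩)

/-! ### Failure of polyconvexity -/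

theorem energy_diag {a p : ℝ} (h : |p| < a) :
    0 < (ofParts a 0 p 0).det ∧ energy (ofParts a 0 p 0) =
      2 * a / (a - |p|) + 2 * Real.log (a - |p|) - 1 + 1 / (a ^ 2 - p ^ 2) := by
  have ha : 0 ≤ a := (abs_nonneg p).trans h.le
  have hd : 0 < (ofParts a 0 p 0).det := by
    rw [det_ofParts]
    have := sq_lt_sq' (by linarith [abs_nonneg p]) h
    rw [sq_abs] at this
    linarith
  refine ⟨hd, ?_⟩
  rw [energy_eq hd, det_ofParts, confSq_ofParts, antiSq_ofParts]
  simp [Real.sqrt_sq ha, Real.sqrt_sq_eq_abs]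

theorem not_isPolyconvex_W₀ : ¬ IsPolyconvex (fun F => (W₀ F : WithTop ℝ)) := by
  rintro ⟨P, hP, hW⟩
  have hval : ∀ a p : ℝ, |p| < a → P (ofParts a 0 p 0, a ^ 2 - p ^ 2) =
      ((2 * a / (a - |p|) + 2 * Real.log (a - |p|) - 1 + 1 / (a ^ 2 - p ^ 2) : ℝ) : WithTop ℝ) := by
    intro a p h
    obtain ⟨hd, he⟩ := energy_diag h
    obtain ⟨F, hF⟩ := exists_mat_eq hd
    have : (W₀ F : WithTop ℝ) = P (mat F, (mat F).det) := hW F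
    rw [W₀_eq_energy, hF, he, det_ofParts] at this
    rw [this]
    simp
  -- The point `(1 - t)(1, 1) + t (A • 1, A² - p²)` lies on the graph of `det` when `p² = (1 - t)(A
  -- - 1)²`. Here `t = 3/4`, `A = 161`, `p = 80`, and `A - p = 3⁴` eases the logarithms.
  have v0 := hval 1 0 (by norm_num)
  have v1 := hval 161 80 (by norm_num)
  have v2 := hval 161 (-80) (by norm_num)
  have v3 := hval 121 0 (by norm_num)
  have c1 := hP (ofParts 161 0 80 0, 161 ^ 2 - 80 ^ 2) (ofParts 161 0 (-80) 0, 161 ^ 2 - (-80) ^ 2)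
    (1 / 2) (by norm_num) (by norm_num)
  have c2 := hP (ofParts 1 0 0 0, 1 ^ 2 - 0 ^ 2) (ofParts 161 0 0 0, 19521)
    (3 / 4) (by norm_num) (by norm_num)
  have e1 : ((1 - 1 / 2 : ℝ) • ((ofParts 161 0 80 0, 161 ^ 2 - 80 ^ 2) : Mat2 × ℝ) +
      (1 / 2 : ℝ) • ((ofParts 161 0 (-80) 0, 161 ^ 2 - (-80) ^ 2) : Mat2 × ℝ)) =
      (ofParts 161 0 0 0, 19521) := by
    ext i j
    · fin_cases i <;> fin_cases j <;> simp [ofParts] <;> norm_num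
    · simp; norm_num
  have e2 : ((1 - 3 / 4 : ℝ) • ((ofParts 1 0 0 0, 1 ^ 2 - 0 ^ 2) : Mat2 × ℝ) +
      (3 / 4 : ℝ) • ((ofParts 161 0 0 0, 19521) : Mat2 × ℝ)) =
      (ofParts 121 0 0 0, 121 ^ 2 - 0 ^ 2) := by
    ext i j
    · fin_cases i <;> fin_cases j <;> simp [ofParts] <;> norm_num
    · simp; norm_num
  rw [e1, v1, v2] at c1
  rw [e2, v0, v3] at c2
  rw [← WithTop.coe_mul, ← WithTop.coe_mul, ← WithTop.coe_add] at c1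
  -- The point `(161 • 1, 19521)` is off the graph of `det`, so finiteness of `P` there has to come
  -- from `c1`.
  obtain ⟨m, hm, hm1⟩ := WithTop.le_coe_iff.1 c1
  rw [hm, ← WithTop.coe_mul, ← WithTop.coe_mul, ← WithTop.coe_add, WithTop.coe_le_coe] at c2
  norm_num at c2 hm1
  have h3 : Real.log 81 = 4 * Real.log 3 := by
    rw [show (81 : ℝ) = 3 ^ 4 by norm_num, Real.log_pow]; norm_num
  have h4 : Real.log 81 ≤ Real.log 121 := Real.log_le_log (by norm_num) (by norm_num)
  have h5 : 1 < Real.log 3 := by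
    rw [Real.lt_log_iff_exp_lt (by norm_num)]
    linarith [Real.exp_one_lt_d9]
  linarith

end Mielke

theorem mainTheorem2 :
    (Mielke.IsObjectiveIsotropic (fun F => (Mielke.W₀ F : WithTop ℝ)) ∧
      Mielke.IsRankOneConvex (fun F => (Mielke.W₀ F : WithTop ℝ)) ∧
      (∀ c : ℝ, IsCompact (Mielke.sublevel (fun F => (Mielke.W₀ F : WithTop ℝ)) c) ∧
        IsPreconnected (Mielke.sublevel (fun F => (Mielke.W₀ F : WithTop ℝ)) c)) ∧
      ¬ Mielke.IsPolyconvex (fun F => (Mielke.W₀ F : WithTop ℝ))) ∧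
    ¬ Mielke.MielkeConjecture := by
  have hsub := fun c =>
    And.intro (Mielke.isCompact_sublevel_W₀ c) (Mielke.isPreconnected_sublevel_W₀ c)
  exact ⟨⟨Mielke.isObjectiveIsotropic_W₀, Mielke.isRankOneConvex_W₀, hsub,
    Mielke.not_isPolyconvex_W₀⟩, fun h => Mielke.not_isPolyconvex_W₀
      (h _ Mielke.isObjectiveIsotropic_W₀ Mielke.isRankOneConvex_W₀ hsub)⟩
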